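/- **Vanishing Lemma.** Let $0=\lambda_0<\lambda_1<\lambda_2<\cdots$ be real numbers, let $a_0,a_1,a_2,\dots$ be complex numbers, and consider the general Dirichlet series $$L(s)=\sum_{n=0}^\infty a_n e^{-\lambda_n s}$$ (the choice $\lambda_n=\log(n+1)$ gives the ordinary Dirichlet series $\sum_{n\ge 0} a_n (n+1)^{-s}$). Let $\sigma,t_1,t_2$ be real numbers with $t_1<t_2$, and suppose that for every $t\in(t_1,t_2)$ the series converges absolutely at $s=\sigma+it$ and $L(\sigma+it)=0$. Then the Dirichlet series is identically zero: $a_n=0$ for every $n\ge 0$, and so the series converges absolutely with sum $L(s)=0$ for every $s\in\mathbb{C}$. -/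

import Mathlib

/-- The condition `0 = l 0 < l 1 < l 2 < ⋯` on the frequencies of a general Dirichlet series. -/
structure DirichletCondition (l : ℕ → ℝ) : Prop where
  zero : l 0 = 0
  strictMono : StrictMono l

/-- The `n`-th term `a n * exp (-(l n) * s)` of the general Dirichlet series with coefficients `a`
and frequencies `l`. The frequencies `l n = log (n + 1)` give the terms
`a n * (n + 1) ^ (-s)` of an ordinary Dirichlet series. -/
noncomputable def dirichletTerm (a : ℕ → ℂ) (l : ℕ → ℝ) (s : ℂ) (n : ℕ) : ℂ :=
  a n * Complex.exp (-(l n : ℂ) * s)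

/-- The general Dirichlet series converges absolutely at `s`. -/
def DirichletAbsConvergesAt (a : ℕ → ℂ) (l : ℕ → ℝ) (s : ℂ) : Prop :=
  Summable fun n => ‖dirichletTerm a l s n‖

/-- The sum of the general Dirichlet series at a point `s` of absolute convergence. -/
noncomputable def dirichletSum (a : ℕ → ℂ) (l : ℕ → ℝ) (s : ℂ) : ℂ :=
  ∑' n, dirichletTerm a l s n

open Complex Filter Topology Set

/-! Absolute convergence at one boundary point gives uniform convergence on the closed half-plane to
its right, so the sum is holomorphic inside and continuous up to the line. Vanishing on a segment
then forces it to vanish inside: in a square with one side on the segment, multiply four rotated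
copies and apply the maximum principle, then the identity theorem. The coefficients are recovered
one at a time from the decay as `x → +∞`. -/

/-- The frontier of an axis-parallel square centred at the origin. -/
theorem Complex.re_or_im_of_mem_frontier_square {δ : ℝ} (hδ : 0 < δ) {w : ℂ}
    (hw : w ∈ frontier (Ioo (-δ) δ ×ℂ Ioo (-δ) δ)) :
    (w.re ∈ Icc (-δ) δ ∧ w.im ∈ Icc (-δ) δ) ∧
      (w.re = -δ ∨ w.re = δ ∨ w.im = -δ ∨ w.im = δ) := by
  have hne : -δ ≠ δ := by linarith
  have hlt : -δ < δ := by linarith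
  rw [frontier_reProdIm, closure_Ioo hne, frontier_Ioo hlt] at hw
  simp only [mem_union, mem_reProdIm, mem_insert_iff, mem_singleton_iff, mem_Icc] at hw ⊢
  grind

/-- A function that is holomorphic on a right half-plane, continuous up to the boundary line and
zero on a segment of that line vanishes at the centre of every square in the closed half-plane
with one side on the segment. -/
theorem DiffContOnCl.eq_zero_of_square {f : ℂ → ℂ} {σ t₁ t₂ : ℝ}
    (hf : DiffContOnCl ℂ f {z | σ < z.re})
    (hzero : ∀ t ∈ Ioo t₁ t₂, f (σ + t * I) = 0) {p : ℂ} (hp : σ < p.re)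
    (h₁ : t₁ < p.im - (p.re - σ)) (h₂ : p.im + (p.re - σ) < t₂) : f p = 0 := by
  obtain ⟨δ, hδ⟩ : ∃ δ, δ = p.re - σ := ⟨_, rfl⟩
  have hδ0 : 0 < δ := by linarith
  rw [← hδ] at h₁ h₂
  let U : Set ℂ := Ioo (-δ) δ ×ℂ Ioo (-δ) δ
  have hU : Bornology.IsBounded U := (Metric.isBounded_Ioo _ _).reProdIm (Metric.isBounded_Ioo _ _)
  have hside : ∀ w : ℂ, w.re = -δ → w.im ∈ Icc (-δ) δ → f (p + w) = 0 := by
    intro w hre him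
    have h := hzero (p.im + w.im) ⟨by linarith [him.1], by linarith [him.2]⟩
    rwa [show p + w = (σ : ℂ) + ((p.im + w.im : ℝ) : ℂ) * I from
      Complex.ext (by simp [hre, hδ]) (by simp)]
  have hcomp : ∀ c : ℂ, (∀ w ∈ U, -δ < (c * w).re) →
      DiffContOnCl ℂ (fun w => f (p + c * w)) U := by
    intro c hc
    refine hf.comp (g := fun w => p + c * w) (Differentiable.diffContOnCl (by fun_prop)) ?_
    intro w hw
    have := hc w hw
    simp only [mem_ofPred_eq, add_re]
    linarith
  have hmem : ∀ w ∈ U, (-δ < w.re ∧ w.re < δ) ∧ (-δ < w.im ∧ w.im < δ) := fun w hw => hw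
  -- The product `f(p+w) f(p-w) f(p+iw) f(p-iw)`: each side of the square is carried to the left
  -- side by one of the rotations, so one factor vanishes there. At `w = 0` the product is `f(p)^4`.
  have hG := (((hcomp 1 fun w hw => by simpa using (hmem w hw).1.1).smul
    (hcomp (-1) fun w hw => by simpa using (hmem w hw).1.2)).smul
    ((hcomp I fun w hw => by simpa using (hmem w hw).2.2).smul
    (hcomp (-I) fun w hw => by simpa using (hmem w hw).2.1)))
  have key := Complex.norm_le_of_forall_mem_frontier_norm_le hU hG (C := 0) (z := 0) ?_
    (subset_closure (by simp [U, mem_reProdIm, hδ0]))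
  · simp only [smul_eq_mul, mul_zero, add_zero, norm_le_zero_iff, mul_self_eq_zero] at key
    exact key
  · intro w hw
    obtain ⟨⟨hre, him⟩, h | h | h | h⟩ := re_or_im_of_mem_frontier_square hδ0 hw
    · simp [hside w h him]
    · have := hside (-w) (by simp [h]) (by simp; exact ⟨him.2, by linarith [him.1]⟩)
      simp [this]
    · have := hside (-I * w) (by simp [h]) (by simp; exact ⟨hre.2, by linarith [hre.1]⟩)
      simp only [neg_mul] at this
      simp [this]
    · have := hside (I * w) (by simp [h]) (by simpa using hre)
      simp [this]

/-- Boundary uniqueness: a function that is holomorphic on a right half-plane, continuous up to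
the boundary line and zero on a segment of that line is zero on the half-plane. -/
theorem DiffContOnCl.eqOn_zero_of_boundary_segment {f : ℂ → ℂ} {σ t₁ t₂ : ℝ} (ht : t₁ < t₂)
    (hf : DiffContOnCl ℂ f {z | σ < z.re})
    (hzero : ∀ t ∈ Ioo t₁ t₂, f (σ + t * I) = 0) : EqOn f 0 {z | σ < z.re} := by
  have hopen : IsOpen {z : ℂ | σ < z.re} := isOpen_lt continuous_const continuous_re
  -- A quarter of the length, not half, leaves the square's side strictly inside the segment, so the
  -- same holds for all points near `p`.
  let p : ℂ := ⟨σ + (t₂ - t₁) / 4, (t₁ + t₂) / 2⟩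
  refine (hf.differentiableOn.analyticOnNhd hopen).eqOn_zero_of_preconnected_of_eventuallyEq_zero
    (convex_halfSpace_re_gt σ).isPreconnected (z₀ := p) (by simp [p, ht]) ?_
  have e₁ : ∀ᶠ z : ℂ in 𝓝 p, σ < z.re :=
    hopen.eventually_mem (show σ < p.re by simp only [p]; linarith)
  have e₂ : ∀ᶠ z : ℂ in 𝓝 p, t₁ < z.im - (z.re - σ) :=
    (isOpen_lt continuous_const
      (continuous_im.sub (continuous_re.sub continuous_const))).eventually_mem
      (show t₁ < p.im - (p.re - σ) by simp only [p]; linarith)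
  have e₃ : ∀ᶠ z : ℂ in 𝓝 p, z.im + (z.re - σ) < t₂ :=
    (isOpen_lt (continuous_im.add (continuous_re.sub continuous_const))
      continuous_const).eventually_mem
      (show p.im + (p.re - σ) < t₂ by simp only [p]; linarith)
  filter_upwards [e₁, e₂, e₃] with z h₁ h₂ h₃
  exact hf.eq_zero_of_square hzero h₁ h₂ h₃

theorem norm_dirichletTerm (a : ℕ → ℂ) (l : ℕ → ℝ) (s : ℂ) (n : ℕ) :
    ‖dirichletTerm a l s n‖ = ‖a n‖ * Real.exp (-(l n * s.re)) := by
  simp [dirichletTerm, norm_exp]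

theorem DirichletCondition.nonneg {l : ℕ → ℝ} (hl : DirichletCondition l) (n : ℕ) : 0 ≤ l n :=
  hl.zero ▸ hl.strictMono.monotone n.zero_le

theorem norm_dirichletTerm_le {a : ℕ → ℂ} {l : ℕ → ℝ} (hl : DirichletCondition l) {s w : ℂ}
    (h : s.re ≤ w.re) (n : ℕ) : ‖dirichletTerm a l w n‖ ≤ ‖dirichletTerm a l s n‖ := by
  rw [norm_dirichletTerm, norm_dirichletTerm]
  have := hl.nonneg n
  gcongr

theorem differentiable_dirichletTerm (a : ℕ → ℂ) (l : ℕ → ℝ) (n : ℕ) :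
    Differentiable ℂ fun s => dirichletTerm a l s n := by
  unfold dirichletTerm
  fun_prop

/-- A general Dirichlet series that converges absolutely at `s` is holomorphic to the right of `s`
and continuous up to the vertical line through `s`. -/
theorem DirichletAbsConvergesAt.diffContOnCl {a : ℕ → ℂ} {l : ℕ → ℝ} (hl : DirichletCondition l)
    {s : ℂ} (hs : DirichletAbsConvergesAt a l s) :
    DiffContOnCl ℂ (dirichletSum a l) {z | s.re < z.re} := by
  refine ⟨differentiableOn_tsum_of_summable_norm hs
    (fun n => (differentiable_dirichletTerm a l n).differentiableOn)
    (isOpen_lt continuous_const continuous_re)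
    (fun n w hw => norm_dirichletTerm_le hl (le_of_lt hw) n), ?_⟩
  refine (continuousOn_tsum (s := {z : ℂ | s.re ≤ z.re})
    (fun n => (differentiable_dirichletTerm a l n).continuous.continuousOn) hs
    (fun n w hw => norm_dirichletTerm_le hl hw n)).mono ?_
  exact closure_minimal (fun z (hz : s.re < z.re) => hz.le) (isClosed_le continuous_const continuous_re)

/-- The coefficients of a general Dirichlet series are determined by its sum on a real
half-line. -/
theorem DirichletAbsConvergesAt.coeff_eq_zero {a : ℕ → ℂ} {l : ℕ → ℝ}
    (hl : DirichletCondition l) {s : ℂ} (hs : DirichletAbsConvergesAt a l s)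
    (hzero : ∀ x : ℝ, s.re < x → dirichletSum a l x = 0) (n : ℕ) : a n = 0 := by
  induction n using Nat.strong_induction_on with
  | _ n ih =>
  -- After scaling by `exp (l n * x)`, terms below `n` vanish by induction, the `n`-th is constant
  -- and later ones decay. Since `l n ≤ l m`, their norms decrease in `x`, so the values at `x =
  -- s.re` dominate.
  have hlim : Tendsto (fun x : ℝ => ∑' m, exp (l n * x) * dirichletTerm a l x m) atTop
      (𝓝 (∑' m, if m = n then a n else 0)) := by
    refine tendsto_tsum_of_dominated_convergence
      (bound := fun m => Real.exp (l n * s.re) * ‖dirichletTerm a l s m‖)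
      (Summable.mul_left _ hs) ?_ ?_
    · intro m
      rcases lt_trichotomy m n with h | rfl | h
      · simp [h.ne, dirichletTerm, ih m h]
      · refine tendsto_const_nhds.congr fun x => ?_
        rw [if_pos rfl, dirichletTerm, mul_left_comm, ← exp_add]
        simp
      · rw [if_neg h.ne', tendsto_zero_iff_norm_tendsto_zero]
        have hpos : 0 < l m - l n := sub_pos.2 (hl.strictMono h)
        have := (Real.tendsto_exp_neg_atTop_nhds_zero.comp
          (tendsto_id.const_mul_atTop hpos)).const_mul ‖a m‖
        rw [mul_zero] at this
        refine this.congr fun x => ?_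
        rw [norm_mul, norm_dirichletTerm, norm_exp, mul_left_comm, ← Real.exp_add]
        simp only [Function.comp_apply, id, mul_re, ofReal_re, ofReal_im]
        ring_nf
    · filter_upwards [eventually_ge_atTop s.re] with x hx m
      rcases lt_or_ge m n with h | h
      · simp [dirichletTerm, ih m h]
      · rw [norm_mul, norm_dirichletTerm, norm_dirichletTerm, norm_exp, mul_left_comm,
          mul_left_comm (Real.exp _), ← Real.exp_add, ← Real.exp_add]
        have hmn : l n ≤ l m := hl.strictMono.monotone h
        refine mul_le_mul_of_nonneg_left (Real.exp_le_exp.2 ?_) (norm_nonneg _)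
        simp only [mul_re, ofReal_re, ofReal_im]
        nlinarith
  rw [tsum_ite_eq] at hlim
  refine tendsto_nhds_unique hlim (tendsto_const_nhds.congr' ?_)
  filter_upwards [eventually_gt_atTop s.re] with x hx
  rw [tsum_mul_left, show ∑' m, dirichletTerm a l x m = 0 from hzero x hx, mul_zero]

theorem mainTheorem12 (a : ℕ → ℂ) (l : ℕ → ℝ) (hl : DirichletCondition l)
    (σ t₁ t₂ : ℝ) (ht : t₁ < t₂)
    (hconv : ∀ t ∈ Set.Ioo t₁ t₂, DirichletAbsConvergesAt a l ((σ : ℂ) + (t : ℂ) * Complex.I))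
    (hzero : ∀ t ∈ Set.Ioo t₁ t₂, dirichletSum a l ((σ : ℂ) + (t : ℂ) * Complex.I) = 0) :
    (∀ n, a n = 0) ∧
      ∀ s : ℂ, DirichletAbsConvergesAt a l s ∧ dirichletSum a l s = 0 := by
  obtain ⟨t, htmem⟩ := exists_between ht
  have hs := hconv t htmem
  have hre : ((σ : ℂ) + (t : ℂ) * I).re = σ := by simp
  have hd := hs.diffContOnCl hl
  rw [hre] at hd
  have hL := hd.eqOn_zero_of_boundary_segment ht hzero
  have ha : ∀ n, a n = 0 := hs.coeff_eq_zero hl fun x hx => hL (by simpa [hre] using hx)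
  refine ⟨ha, fun s => ?_⟩
  simp [DirichletAbsConvergesAt, dirichletSum, dirichletTerm, ha]
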